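/- Let $A$ be a complex Banach algebra with identity $\mathbf 1$ and let $a,b\in A$. Let $C_{a,b}\colon A\to A$ be the operator $C_{a,b}x=ax-xb$, put $$\rho(a,b)=\limsup_{n\to\infty}\bigl\|C_{a,b}^n\mathbf 1\bigr\|^{1/n},$$ let $\sigma(x)=\{\lambda\in\mathbb C:\lambda\mathbf 1-x\text{ is not invertible in }A\}$, and let $$\operatorname{pco}(K)=\Bigl\{z\in\mathbb C: |p(z)|\le \sup_{w\in K}|p(w)|\text{ for every complex polynomial }p\Bigr\}$$ be the polynomially convex hull of a compact set $K\subset\mathbb C$ (with $\operatorname{pco}(\emptyset)=\emptyset$). (1) If $0\notin\operatorname{pco}(\sigma(a)\cup\sigma(b))$, then $a$ and $b$ are invertible, and $a=b$ if and only if $\rho(a,b)=0$ and $\sup_{n\in\mathbb Z}\|a^nb^{-n}\|<\infty$. (2) For arbitrary $a,b\in A$, $a=b$ if and only if $\rho(a,b)=0$ and there exists $\alpha\in\mathbb C$ with $-\alpha\notin\operatorname{pco}(\sigma(a)\cup\sigma(b))$ (so that $\alpha\mathbf 1+a$ and $\alpha\mathbf 1+b$ are invertible) such that $$\sup_{n\in\mathbb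 Z}\bigl\|(\alpha\mathbf 1+a)^n(\alpha\mathbf 1+b)^{-n}\bigr\|<\infty.$$ (3) The same holds with the condition on the sign of $\alpha$ changed: $a=b$ if and only if $\rho(a,b)=0$ and there exists $\alpha\in\mathbb C$ with $\alpha\notin\operatorname{pco}(\sigma(a)\cup\sigma(b))$ such that $\alpha\mathbf 1+a$ and $\alpha\mathbf 1+b$ are invertible and $$\sup_{n\in\mathbb Z}\bigl\|(\alpha\mathbf 1+a)^n(\alpha\mathbf 1+b)^{-n}\bigr\|<\infty.$$ -/

import Mathlib

namespace GelfandGen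

/-- The polynomially convex hull of a set `K` of complex numbers: all `z` such that
`|p(z)| ≤ sup_K |p|` for every complex polynomial `p`. The supremum is taken in `[0, ∞]`. -/
def pco (K : Set ℂ) : Set ℂ :=
  {z | ∀ p : Polynomial ℂ, ‖p.eval z‖ₑ ≤ ⨆ w ∈ K, ‖p.eval w‖ₑ}

/-- The operator `C_{a,b} = L_a - R_b` on `A`, i.e. `x ↦ a x - x b`. -/
noncomputable def C {A : Type*} [NormedRing A] [NormedAlgebra ℂ A] (a b : A) : A →ₗ[ℂ] A :=
  LinearMap.mulLeft ℂ a - LinearMap.mulRight ℂ b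

/-- `ρ(a,b) = limsup_n ‖C_{a,b}^n 1‖^{1/n}`. The sequence is bounded, see `isBounded_rho`. -/
noncomputable def rho {A : Type*} [NormedRing A] [NormedAlgebra ℂ A] (a b : A) : ℝ :=
  Filter.limsup (fun n : ℕ => ‖(C a b ^ n) 1‖ ^ (1 / (n : ℝ))) Filter.atTop

/-- Integer powers of an element of a ring; negative powers are powers of the inverse.
They are only meaningful for invertible elements, see `intPow_unit`. -/
noncomputable def intPow {A : Type*} [Ring A] (a : A) : ℤ → A
  | Int.ofNat n => a ^ n
  | Int.negSucc n => Ring.inverse a ^ (n + 1)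

theorem intPow_unit {A : Type*} [Ring A] (u : Aˣ) (n : ℤ) :
    intPow (u : A) n = ((u ^ n : Aˣ) : A) := by
  cases n with
  | ofNat n => simp [intPow]
  | negSucc n => simp [intPow, zpow_negSucc, ← inv_pow]

theorem norm_C_pow_le {A : Type*} [NormedRing A] [NormedAlgebra ℂ A] (a b : A) (n : ℕ) :
    ‖(C a b ^ n) 1‖ ≤ (‖a‖ + ‖b‖) ^ n * ‖(1 : A)‖ := by
  induction n with
  | zero => simp
  | succ n ih =>
    rw [pow_succ', Module.End.mul_apply]
    set x := (C a b ^ n) 1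
    have h : ‖C a b x‖ ≤ (‖a‖ + ‖b‖) * ‖x‖ := by
      have h1 : C a b x = a * x - x * b := by simp [C]
      rw [h1]
      calc ‖a * x - x * b‖ ≤ ‖a * x‖ + ‖x * b‖ := norm_sub_le _ _
        _ ≤ ‖a‖ * ‖x‖ + ‖x‖ * ‖b‖ := add_le_add (norm_mul_le _ _) (norm_mul_le _ _)
        _ = (‖a‖ + ‖b‖) * ‖x‖ := by ring
    calc _ ≤ (‖a‖ + ‖b‖) * ‖x‖ := h
      _ ≤ (‖a‖ + ‖b‖) * ((‖a‖ + ‖b‖) ^ n * ‖(1 : A)‖) := by gcongr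
      _ = _ := by ring

theorem isBounded_rho {A : Type*} [NormedRing A] [NormedAlgebra ℂ A] (a b : A) :
    BddAbove (Set.range fun n : ℕ => ‖(C a b ^ n) 1‖ ^ (1 / (n : ℝ))) := by
  refine ⟨max 1 ((‖a‖ + ‖b‖) * max 1 ‖(1 : A)‖), ?_⟩
  rintro _ ⟨n, rfl⟩
  rcases Nat.eq_zero_or_pos n with rfl | hn
  · simp
  refine le_trans ?_ (le_max_right _ _)
  have h1 : ‖(C a b ^ n) 1‖ ≤ ((‖a‖ + ‖b‖) * max 1 ‖(1 : A)‖) ^ n := by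
    refine (norm_C_pow_le a b n).trans ?_
    rw [mul_pow]
    gcongr
    exact (le_max_right _ _).trans (le_self_pow₀ (le_max_left _ _) hn.ne')
  calc _ ≤ (((‖a‖ + ‖b‖) * max 1 ‖(1 : A)‖) ^ n) ^ (1 / (n : ℝ)) :=
        Real.rpow_le_rpow (norm_nonneg _) h1 (by positivity)
    _ = _ := by
      rw [one_div]
      exact Real.pow_rpow_inv_natCast (by positivity) hn.ne'

end GelfandGen

/-! For invertible `a`, `b` let `T x = a x b⁻¹`. Then `T ^ n 1 = a ^ n b ^ (-n)` and `(T - 1) ^ n 1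
= (C ^ n 1) b ^ (-n)`, so the hypotheses say that `1` has a bounded two-sided `T`-orbit and is
locally quasinilpotent for `D = T - 1`. The local Gelfand–Hille theorem
`apply_eq_self_of_locallyQuasinilpotent` gives `T 1 = 1`, that is, `a = b`.

That theorem rests on the entire function `y(w) = ∑ w ^ k D ^ k x`, which solves `(1 + w) y = x + w
T y`. Iterating with `T` or its left inverse `S` gives `‖y(w)‖ * |‖1 + w‖ - ‖w‖| ≤ M`
(`norm_localResolvent_mul_le`). This degenerates only near a line, where the maximum principle
repairs it (`norm_le_of_norm_mul_abs_re_le`). By Liouville `y` is constant, and `y(1) = y(0) = x`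
forces `D x = 0`.

The polynomial hull serves only to make the shifted elements invertible; scalar shifts do not change
`C`. -/

open Filter Topology

/-! ### Subexponential growth of forward and backward orbits -/

section LocalGelfandHille

variable {X : Type*} [NormedAddCommGroup X] [NormedSpace ℂ X]

/-- `x` is locally quasinilpotent for `D`: the orbit `D ^ k x` decays faster than any
geometric sequence. -/
def LocallyQuasinilpotent (D : X →L[ℂ] X) (x : X) : Prop :=
  ∀ ε : ℝ, 0 < ε → ∃ K : ℝ, 0 ≤ K ∧ ∀ k : ℕ, ‖(D ^ k) x‖ ≤ K * ε ^ k

/-- The `Q`-orbits of the vectors `D ^ k x` grow subexponentially, uniformly in `k`. -/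
def SubexponentialOrbit (D Q : X →L[ℂ] X) (x : X) : Prop :=
  ∀ ρ η : ℝ, 1 < ρ → 0 < η → ∃ K : ℝ, 0 ≤ K ∧
    ∀ N k : ℕ, ‖(Q ^ N) ((D ^ k) x)‖ ≤ K * η ^ k * ρ ^ N

/-- Since `T ^ (N+1) D ^ k x = T ^ N D ^ k x + T ^ N D ^ (k+1) x`, each power of `T` costs a factor
`1 + ε`. -/
theorem LocallyQuasinilpotent.subexponentialOrbit_one_add {D T : X →L[ℂ] X} {x : X}
    (h : LocallyQuasinilpotent D x) (hT : T = 1 + D) : SubexponentialOrbit D T x := by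
  intro ρ η hρ hη
  obtain ⟨K, hK, hb⟩ := h (min η (ρ - 1)) (lt_min hη (by linarith))
  set ε := min η (ρ - 1) with hε
  have hε0 : 0 < ε := lt_min hη (by linarith)
  have hεη : ε ≤ η := min_le_left _ _
  have hερ : 1 + ε ≤ ρ := by linarith [min_le_right η (ρ - 1)]
  have main : ∀ N k : ℕ, ‖(T ^ N) ((D ^ k) x)‖ ≤ K * ε ^ k * (1 + ε) ^ N := by
    intro N
    induction N with
    | zero => intro k; simpa using hb k
    | succ N ih =>
      intro k
      have e : (T ^ (N + 1)) ((D ^ k) x) = (T ^ N) ((D ^ k) x) + (T ^ N) ((D ^ (k + 1)) x) := by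
        rw [pow_succ T, pow_succ' D, mul_apply_eq_comp, mul_apply_eq_comp,
          ← map_add]
        congr 1
        simp [hT]
      rw [e]
      calc _ ≤ K * ε ^ k * (1 + ε) ^ N + K * ε ^ (k + 1) * (1 + ε) ^ N :=
            (norm_add_le _ _).trans (add_le_add (ih k) (ih (k + 1)))
        _ = _ := by ring
  refine ⟨K, hK, fun N k => (main N k).trans ?_⟩
  gcongr

/-- Here `S ^ (N+1) D ^ k x = S ^ N D ^ k x - S ^ (N+1) D ^ (k+1) x`. Unrolling in `k` gives a
geometric series, so each power of `S` costs a factor `1 / (1 - ε)`; the tail vanishes because `D ^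
(k+m) x` tends to `0`. -/
theorem LocallyQuasinilpotent.subexponentialOrbit_inv {D S : X →L[ℂ] X} {x : X}
    (h : LocallyQuasinilpotent D x) (hS : S = 1 - S * D) : SubexponentialOrbit D S x := by
  intro ρ η hρ hη
  have hρ0 : 0 < ρ := by linarith
  have hpos : 0 < 1 - 1 / ρ := by
    have : 1 / ρ < 1 := by rw [div_lt_one hρ0]; exact hρ
    linarith
  obtain ⟨K, hK, hb⟩ := h (min η (1 - 1 / ρ)) (lt_min hη hpos)
  set ε := min η (1 - 1 / ρ) with hε
  have hε0 : 0 < ε := lt_min hη hpos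
  have hεη : ε ≤ η := min_le_left _ _
  have hερ : 1 / ρ ≤ 1 - ε := by linarith [min_le_right η (1 - 1 / ρ)]
  have h1ε : 0 < 1 - ε := lt_of_lt_of_le (by positivity) hερ
  have hε1 : ε < 1 := by linarith
  have main : ∀ N k : ℕ, ‖(S ^ N) ((D ^ k) x)‖ ≤ K * ε ^ k * (1 / (1 - ε)) ^ N := by
    intro N
    induction N with
    | zero => intro k; simpa using hb k
    | succ N ih =>
      intro k
      have e : ∀ k, (S ^ (N + 1)) ((D ^ k) x) =
          (S ^ N) ((D ^ k) x) - (S ^ (N + 1)) ((D ^ (k + 1)) x) := by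
        intro k
        rw [pow_succ S, pow_succ' D, mul_apply_eq_comp, mul_apply_eq_comp,
          mul_apply_eq_comp, ← map_sub]
        congr 1
        conv_lhs => rw [hS]
        simp
      set B := K * (1 / (1 - ε)) ^ N with hB
      have hB0 : 0 ≤ B := by positivity
      have ih' : ∀ k, ‖(S ^ N) ((D ^ k) x)‖ ≤ B * ε ^ k := fun k => (ih k).trans_eq (by ring)
      have step : ∀ m k, ‖(S ^ (N + 1)) ((D ^ k) x)‖ ≤
          B * ε ^ k * (1 / (1 - ε)) + ‖(S ^ (N + 1)) ((D ^ (k + m)) x)‖ := by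
        intro m
        induction m with
        | zero =>
            intro k
            simp only [add_zero]
            linarith [show 0 ≤ B * ε ^ k * (1 / (1 - ε)) by positivity]
        | succ m ihm =>
          intro k
          have h1 := ihm (k + 1)
          rw [show k + 1 + m = k + (m + 1) by ring] at h1
          have h2 : ‖(S ^ (N + 1)) ((D ^ k) x)‖ ≤
              B * ε ^ k + ‖(S ^ (N + 1)) ((D ^ (k + 1)) x)‖ := by
            rw [e k]
            exact (norm_sub_le _ _).trans (by linarith [ih' k])
          have h3 : B * ε ^ k + B * ε ^ (k + 1) * (1 / (1 - ε)) = B * ε ^ k * (1 / (1 - ε)) := by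
            field_simp
            ring
          linarith
      have lim : Tendsto (fun m => B * ε ^ k * (1 / (1 - ε)) +
          ‖S ^ (N + 1)‖ * (K * ε ^ (k + m))) atTop
          (𝓝 (B * ε ^ k * (1 / (1 - ε)) + ‖S ^ (N + 1)‖ * (K * (ε ^ k * 0)))) := by
        simp only [pow_add ε k]
        exact (((tendsto_pow_atTop_nhds_zero_of_lt_one hε0.le hε1).const_mul _).const_mul _
          |>.const_mul _).const_add _
      have := ge_of_tendsto' lim (fun m => (step m k).trans (by
        gcongr
        exact ((S ^ (N + 1)).le_opNorm _).trans (by gcongr; exact hb _)))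
      refine this.trans_eq ?_
      rw [hB]
      ring
  refine ⟨K, hK, fun N k => (main N k).trans ?_⟩
  have : 1 / (1 - ε) ≤ ρ := by
    rw [div_le_iff₀ h1ε]
    rwa [div_le_iff₀ hρ0, mul_comm] at hερ
  gcongr

/-! ### Neumann series and maximum principle estimates -/

/-- If `y` solves `y = c Q y + d x` and the orbit of `x` is bounded, then `y` is given by the
Neumann series, provided the remainder vanishes; this is the resulting norm bound. -/
theorem norm_mul_le_of_neumann {Q : X →L[ℂ] X} {x y : X} {c d : ℂ} {M : ℝ}
    (hy : y = c • Q y + d • x) (hM : ∀ n : ℕ, ‖(Q ^ n) x‖ ≤ M) (hc : ‖c‖ < 1)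
    (hlim : Tendsto (fun N => ‖c‖ ^ N * ‖(Q ^ N) y‖) atTop (𝓝 0)) :
    ‖y‖ * (1 - ‖c‖) ≤ ‖d‖ * M := by
  have step : ∀ N : ℕ, ‖y‖ * (1 - ‖c‖) ≤
      ‖d‖ * M * (1 - ‖c‖ ^ N) + (1 - ‖c‖) * (‖c‖ ^ N * ‖(Q ^ N) y‖) := by
    intro N
    induction N with
    | zero => simp [mul_comm]
    | succ N ih =>
      have h1 : (Q ^ N) y = c • (Q ^ (N + 1)) y + d • (Q ^ N) x := by
        conv_lhs => rw [hy]
        rw [pow_succ, mul_apply_eq_comp, map_add, map_smul, map_smul]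
      have h2 : ‖(Q ^ N) y‖ ≤ ‖c‖ * ‖(Q ^ (N + 1)) y‖ + ‖d‖ * M := by
        rw [h1]
        refine (norm_add_le _ _).trans ?_
        rw [norm_smul, norm_smul]
        gcongr
        exact hM N
      have h3 : (1 - ‖c‖) * (‖c‖ ^ N * ‖(Q ^ N) y‖) ≤
          (1 - ‖c‖) * (‖c‖ ^ N * (‖c‖ * ‖(Q ^ (N + 1)) y‖ + ‖d‖ * M)) := by
        have : 0 ≤ 1 - ‖c‖ := by linarith
        gcongr
      refine (ih.trans (add_le_add_right h3 _)).trans_eq ?_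
      ring
  have lim : Tendsto (fun N => ‖d‖ * M * (1 - ‖c‖ ^ N) + (1 - ‖c‖) * (‖c‖ ^ N * ‖(Q ^ N) y‖))
      atTop (𝓝 (‖d‖ * M * (1 - 0) + (1 - ‖c‖) * 0)) :=
    (((tendsto_pow_atTop_nhds_zero_of_lt_one (norm_nonneg c) hc).const_sub 1).const_mul _).add
      (hlim.const_mul _)
  simpa using ge_of_tendsto' lim step

/-- An entire function which is bounded by `M (2 |z| + 1) / |2 Re z|` is bounded. -/
theorem norm_le_of_norm_mul_abs_re_le {f : ℂ → X} (hf : Differentiable ℂ f) {M : ℝ}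
    (hM : 0 ≤ M) (hb : ∀ z, ‖f z‖ * |2 * z.re| ≤ M * (2 * ‖z‖ + 1)) (z : ℂ) : ‖f z‖ ≤ 4 * M := by
  -- `r ≥ 2 ‖z‖` gives `‖z ^ 2 + r ^ 2‖ ≥ 3/4 r ^ 2`, and `r ≥ 1` gives `2 r + 1 ≤ 3 r`.
  set r := max 1 (2 * ‖z‖) with hr
  have hr1 : 1 ≤ r := le_max_left _ _
  have hr0 : 0 < r := by linarith
  have hzr : 2 * ‖z‖ ≤ r := le_max_right _ _
  -- On `‖ζ‖ = r` this multiplier has modulus `r |2 Re ζ|`, which is exactly the factor that the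
  -- hypothesis controls.
  have hd : Differentiable ℂ fun ζ : ℂ => (ζ ^ 2 + (r : ℂ) ^ 2) • f ζ := by fun_prop
  have hball : ‖(z ^ 2 + (r : ℂ) ^ 2) • f z‖ ≤ M * r * (2 * r + 1) := by
    refine Complex.norm_le_of_forall_mem_frontier_norm_le (U := Metric.ball 0 r)
      Metric.isBounded_ball hd.diffContOnCl (fun ζ hζ => ?_) ?_
    · rw [frontier_ball _ hr0.ne', mem_sphere_zero_iff_norm] at hζ
      have hsq : (r : ℂ) ^ 2 = ζ * (starRingEnd ℂ) ζ := by
        rw [Complex.mul_conj, Complex.normSq_eq_norm_sq, hζ]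
        push_cast
        rfl
      have hn : ‖ζ ^ 2 + (r : ℂ) ^ 2‖ = r * |2 * ζ.re| := by
        rw [hsq, show ζ ^ 2 + ζ * (starRingEnd ℂ) ζ = ζ * (ζ + (starRingEnd ℂ) ζ) by ring,
          Complex.add_conj, norm_mul, hζ, Complex.norm_real, Real.norm_eq_abs]
      rw [norm_smul, hn]
      have := hb ζ
      rw [hζ] at this
      calc _ = r * (‖f ζ‖ * |2 * ζ.re|) := by ring
        _ ≤ r * (M * (2 * r + 1)) := by gcongr
        _ = _ := by ring
    · exact subset_closure (by simp only [mem_ball_zero_iff]; linarith [norm_nonneg z])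
  rw [norm_smul] at hball
  have hlow : 3 / 4 * r ^ 2 ≤ ‖z ^ 2 + (r : ℂ) ^ 2‖ := by
    have h1 : ‖(r : ℂ) ^ 2‖ - ‖z ^ 2‖ ≤ ‖z ^ 2 + (r : ℂ) ^ 2‖ := by
      rw [add_comm]
      exact norm_sub_le_norm_add _ _
    rw [norm_pow, norm_pow, Complex.norm_real, Real.norm_of_nonneg hr0.le] at h1
    nlinarith [norm_nonneg z]
  have h1 : 3 / 4 * r ^ 2 * ‖f z‖ ≤ M * r * (2 * r + 1) :=
    (mul_le_mul_of_nonneg_right hlow (norm_nonneg _)).trans hball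
  have h2 : M * r * (2 * r + 1) ≤ 3 / 4 * r ^ 2 * (4 * M) := by
    have : 0 ≤ M * r * (r - 1) := mul_nonneg (by positivity) (by linarith)
    nlinarith
  exact le_of_mul_le_mul_left (h1.trans h2) (by positivity)

/-! ### The local resolvent and the local Gelfand–Hille theorem -/

/-- The local resolvent `∑ w ^ k D ^ k x`, a solution of `(1 - w D) y = x`. -/
noncomputable def localResolvent (D : X →L[ℂ] X) (x : X) (w : ℂ) : X :=
  ∑' k : ℕ, w ^ k • (D ^ k) x

theorem LocallyQuasinilpotent.exists_bound {D : X →L[ℂ] X} {x : X}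
    (h : LocallyQuasinilpotent D x) (R : ℝ) (hR : 0 ≤ R) :
    ∃ u : ℕ → ℝ, Summable u ∧ ∀ k (w : ℂ), ‖w‖ ≤ R → ‖w ^ k • (D ^ k) x‖ ≤ u k := by
  obtain ⟨K, hK, hb⟩ := h (1 / (2 * (R + 1))) (by positivity)
  refine ⟨fun k => K * (R * (1 / (2 * (R + 1)))) ^ k, ?_, fun k w hw => ?_⟩
  · refine (summable_geometric_of_lt_one (by positivity) ?_).mul_left K
    rw [mul_one_div, div_lt_one (by positivity)]
    linarith
  · rw [norm_smul, norm_pow]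
    calc _ ≤ R ^ k * (K * (1 / (2 * (R + 1))) ^ k) := by gcongr; exact hb k
      _ = _ := by simp only [mul_pow]; ring

variable [CompleteSpace X]

theorem LocallyQuasinilpotent.summable {D : X →L[ℂ] X} {x : X}
    (h : LocallyQuasinilpotent D x) (w : ℂ) : Summable fun k : ℕ => w ^ k • (D ^ k) x := by
  obtain ⟨u, hu, hb⟩ := h.exists_bound ‖w‖ (norm_nonneg w)
  exact .of_norm_bounded hu fun k => hb k w le_rfl

theorem LocallyQuasinilpotent.differentiable_localResolvent {D : X →L[ℂ] X} {x : X}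
    (h : LocallyQuasinilpotent D x) : Differentiable ℂ (localResolvent D x) := by
  intro w
  obtain ⟨u, hu, hb⟩ := h.exists_bound (‖w‖ + 1) (by positivity)
  have hd : DifferentiableOn ℂ (fun z : ℂ => ∑' k : ℕ, z ^ k • (D ^ k) x)
      (Metric.ball 0 (‖w‖ + 1)) := by
    refine Complex.differentiableOn_tsum_of_summable_norm hu (fun k => ?_) Metric.isOpen_ball
      fun k z hz => hb k z ?_
    · exact ((differentiable_id.pow k).smul_const _).differentiableOn
    · simpa using (mem_ball_zero_iff.1 hz).le
  exact hd.differentiableAt (Metric.isOpen_ball.mem_nhds (by simp))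

theorem LocallyQuasinilpotent.localResolvent_eq {D : X →L[ℂ] X} {x : X}
    (h : LocallyQuasinilpotent D x) (w : ℂ) :
    localResolvent D x w = x + w • D (localResolvent D x w) := by
  have hs := h.summable w
  unfold localResolvent
  rw [D.map_tsum hs, ← tsum_const_smul'' w]
  conv_lhs => rw [hs.tsum_eq_zero_add]
  simp [pow_succ', mul_smul]

/-- Supplies the vanishing remainder for `norm_mul_le_of_neumann`. -/
theorem SubexponentialOrbit.tendsto_localResolvent {D Q : X →L[ℂ] X} {x : X}
    (hQ : SubexponentialOrbit D Q x) (h : LocallyQuasinilpotent D x) (w : ℂ) {t : ℝ}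
    (ht0 : 0 ≤ t) (ht : t < 1) :
    Tendsto (fun N => t ^ N * ‖(Q ^ N) (localResolvent D x w)‖) atTop (𝓝 0) := by
  have hρt : 2 / (1 + t) * t < 1 := by
    rw [div_mul_eq_mul_div, div_lt_one (by positivity)]
    linarith
  -- The rate `ρ = 2 / (1 + t)` exceeds `1` while `ρ t < 1`; `η` makes the series in `k` geometric
  -- with `‖w‖ η < 1`.
  obtain ⟨K, hK, hb⟩ := hQ (2 / (1 + t)) (1 / (2 * (‖w‖ + 1)))
    (by rw [lt_div_iff₀ (by positivity)]; linarith) (by positivity)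
  set ρ := 2 / (1 + t)
  set η := 1 / (2 * (‖w‖ + 1)) with hη
  have hρ0 : 0 ≤ ρ := by positivity
  have hwη : ‖w‖ * η < 1 := by
    rw [hη, mul_one_div, div_lt_one (by positivity)]
    linarith [norm_nonneg w]
  have bound : ∀ N, ‖(Q ^ N) (localResolvent D x w)‖ ≤ ρ ^ N * (K * (1 - ‖w‖ * η)⁻¹) := by
    intro N
    unfold localResolvent
    rw [(Q ^ N).map_tsum (h.summable w)]
    have hg : HasSum (fun k : ℕ => ρ ^ N * (K * (‖w‖ * η) ^ k))
        (ρ ^ N * (K * (1 - ‖w‖ * η)⁻¹)) :=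
      ((hasSum_geometric_of_lt_one (by positivity) hwη).mul_left K).mul_left _
    refine tsum_of_norm_bounded hg fun k => ?_
    rw [map_smul, norm_smul, norm_pow]
    calc _ ≤ ‖w‖ ^ k * (K * η ^ k * ρ ^ N) := by gcongr; exact hb N k
      _ = _ := by ring
  have lim : Tendsto (fun N => (ρ * t) ^ N * (K * (1 - ‖w‖ * η)⁻¹)) atTop
      (𝓝 (0 * (K * (1 - ‖w‖ * η)⁻¹))) :=
    (tendsto_pow_atTop_nhds_zero_of_lt_one (by positivity) hρt).mul_const _
  rw [zero_mul] at lim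
  refine squeeze_zero (fun N => by positivity) (fun N => ?_) lim
  calc _ ≤ t ^ N * (ρ ^ N * (K * (1 - ‖w‖ * η)⁻¹)) := by gcongr; exact bound N
    _ = _ := by ring

/-- If `‖w‖ < ‖1 + w‖`, solve `(1 + w) y = x + w T y` for the left-hand `y` and iterate `T`. If `‖w‖
> ‖1 + w‖`, apply `S` first, solve for the other `y` and iterate `S`. -/
theorem norm_localResolvent_mul_le {D T S : X →L[ℂ] X} {x : X} {M : ℝ}
    (h : LocallyQuasinilpotent D x) (hT : T = 1 + D) (hST : S * T = 1)
    (hMT : ∀ n : ℕ, ‖(T ^ n) x‖ ≤ M) (hMS : ∀ n : ℕ, ‖(S ^ n) x‖ ≤ M) (w : ℂ) :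
    ‖localResolvent D x w‖ * |‖1 + w‖ - ‖w‖| ≤ M := by
  set y := localResolvent D x w with hy
  have hM0 : 0 ≤ M := (norm_nonneg _).trans (hMT 0)
  have hD : D = T - 1 := by rw [hT]; abel
  have e1 : (1 + w) • y = x + w • T y := by
    have := h.localResolvent_eq w
    rw [← hy, hD, sub_apply, one_apply_eq_self, smul_sub] at this
    rw [add_smul, one_smul]
    nth_rw 1 [this]
    abel
  rcases lt_trichotomy ‖w‖ ‖1 + w‖ with hlt | heq | hlt
  · have h0 : 0 < ‖1 + w‖ := (norm_nonneg w).trans_lt hlt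
    have h0' : 1 + w ≠ 0 := norm_pos_iff.1 h0
    have hc : ‖w / (1 + w)‖ < 1 := by rwa [norm_div, div_lt_one h0]
    have ey : y = (w / (1 + w)) • T y + (1 / (1 + w)) • x := by
      have : y = (1 / (1 + w)) • ((1 + w) • y) := by
        rw [smul_smul, one_div_mul_cancel h0', one_smul]
      rw [e1, smul_add, smul_smul, one_div_mul_eq_div] at this
      rw [add_comm]
      exact this
    have := norm_mul_le_of_neumann ey hMT hc
      ((h.subexponentialOrbit_one_add hT).tendsto_localResolvent h w (norm_nonneg _) hc)
    rw [norm_div, norm_div, norm_one] at this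
    rw [abs_of_pos (by linarith)]
    field_simp at this
    exact this
  · rw [heq]; simpa using hM0
  · have h0 : 0 < ‖w‖ := (norm_nonneg _).trans_lt hlt
    have h0' : w ≠ 0 := norm_pos_iff.1 h0
    have hc : ‖(1 + w) / w‖ < 1 := by rwa [norm_div, div_lt_one h0]
    have hSy : S (T y) = y := by rw [← mul_apply_eq_comp, hST]; rfl
    have ey : y = ((1 + w) / w) • S y + (-1 / w) • S x := by
      have h2 : (1 + w) • S y = S x + w • y := by
        rw [← map_smul, e1, map_add, map_smul, hSy]
      have : ((1 + w) / w) • S y = (1 / w) • ((1 + w) • S y) := by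
        rw [smul_smul, one_div_mul_eq_div]
      rw [this, h2, smul_add, smul_smul, one_div_mul_cancel h0', one_smul, neg_div, neg_smul]
      abel
    have hMS' : ∀ n : ℕ, ‖(S ^ n) (S x)‖ ≤ M := fun n => by
      rw [← mul_apply_eq_comp, ← pow_succ]
      exact hMS _
    have hS : S = 1 - S * D := by rw [hD, mul_sub, hST, mul_one]; abel
    have := norm_mul_le_of_neumann ey hMS' hc
      ((h.subexponentialOrbit_inv hS).tendsto_localResolvent h w (norm_nonneg _) hc)
    rw [norm_div, norm_div, norm_neg, norm_one] at this
    rw [abs_of_neg (by linarith), neg_sub]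
    field_simp at this
    exact this

/-- Local Gelfand–Hille theorem: if `x` is locally quasinilpotent for `T - 1` and has a bounded
two-sided orbit under `T`, then `x` is fixed by `T`. -/
theorem apply_eq_self_of_locallyQuasinilpotent {T S : X →L[ℂ] X} {x : X} {M : ℝ}
    (h : LocallyQuasinilpotent (T - 1) x) (hST : S * T = 1)
    (hMT : ∀ n : ℕ, ‖(T ^ n) x‖ ≤ M) (hMS : ∀ n : ℕ, ‖(S ^ n) x‖ ≤ M) : T x = x := by
  have hM0 : 0 ≤ M := (norm_nonneg _).trans (hMT 0)
  -- The shift by `1/2` moves the critical line `‖1 + w‖ = ‖w‖` to the imaginary axis.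
  set f : ℂ → X := fun z => localResolvent (T - 1) x (z - 1 / 2) with hf
  have hdf : Differentiable ℂ f :=
    h.differentiable_localResolvent.comp (differentiable_id.sub_const _)
  have hb : ∀ z, ‖f z‖ * |2 * z.re| ≤ M * (2 * ‖z‖ + 1) := by
    intro z
    have key := norm_localResolvent_mul_le h (by abel) hST hMT hMS (z - 1 / 2)
    rw [show 1 + (z - 1 / 2) = z + 1 / 2 by ring] at key
    have hn : ‖(1 / 2 : ℂ)‖ = 1 / 2 := by norm_num
    have h1 := norm_add_le z (1 / 2)
    have h2 := norm_sub_le z (1 / 2)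
    have hprod : (‖z + 1 / 2‖ - ‖z - 1 / 2‖) * (‖z + 1 / 2‖ + ‖z - 1 / 2‖) = 2 * z.re := by
      have e1 : ‖z + 1 / 2‖ ^ 2 - ‖z - 1 / 2‖ ^ 2 = 2 * z.re := by
        rw [← Complex.normSq_eq_norm_sq, ← Complex.normSq_eq_norm_sq, Complex.normSq_apply,
          Complex.normSq_apply]
        norm_num
        ring
      rw [← e1]
      ring
    have hp0 : 0 ≤ ‖z + 1 / 2‖ + ‖z - 1 / 2‖ := by positivity
    rw [← hprod, abs_mul, abs_of_nonneg hp0, ← mul_assoc]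
    rw [hn] at h1 h2
    exact mul_le_mul key (by linarith) hp0 hM0
  have hbdd : Bornology.IsBounded (Set.range f) :=
    isBounded_iff_forall_norm_le.2 ⟨4 * M, by
      rintro _ ⟨z, rfl⟩
      exact norm_le_of_norm_mul_abs_re_le hdf hM0 hb z⟩
  have hconst : localResolvent (T - 1) x 1 = localResolvent (T - 1) x 0 := by
    have := hdf.apply_eq_apply_of_bounded hbdd (3 / 2) (1 / 2)
    simp only [hf] at this
    norm_num at this
    exact this
  have h0 : localResolvent (T - 1) x 0 = x := by
    have := h.localResolvent_eq 0
    simpa using this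
  have h1 := h.localResolvent_eq 1
  rw [hconst, h0, one_smul] at h1
  simpa using h1.symm

end LocalGelfandHille

/-! ### Transfer to multiplication operators -/

namespace GelfandGen

variable {A : Type*} [NormedRing A] [NormedAlgebra ℂ A]

theorem C_apply (a b x : A) : C a b x = a * x - x * b := by simp [C]

theorem C_algebraMap_add (a b : A) (α : ℂ) :
    C (algebraMap ℂ A α + a) (algebraMap ℂ A α + b) = C a b := by
  ext x
  rw [C_apply, C_apply, add_mul, mul_add, Algebra.commutes α x]
  abel

/-- The limsup gives `ε ^ n` for large `n`; `K` absorbs the finitely many remaining terms. -/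
theorem exists_norm_C_pow_le_of_rho_eq_zero {a b : A} (h : rho a b = 0) {ε : ℝ} (hε : 0 < ε) :
    ∃ K : ℝ, 0 ≤ K ∧ ∀ n : ℕ, ‖(C a b ^ n) 1‖ ≤ K * ε ^ n := by
  have hbdd : IsBoundedUnder (· ≤ ·) atTop
      fun n : ℕ => ‖(C a b ^ n) 1‖ ^ (1 / (n : ℝ)) :=
    (isBounded_rho a b).isBoundedUnder_of_range
  have hev : ∀ᶠ n : ℕ in atTop, ‖(C a b ^ n) 1‖ ^ (1 / (n : ℝ)) < ε :=
    eventually_lt_of_limsup_lt (by rw [rho] at h; rw [h]; exact hε) hbdd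
  have hev' : ∀ᶠ n : ℕ in atTop, ‖(C a b ^ n) 1‖ ≤ 1 * ε ^ n := by
    filter_upwards [hev, eventually_gt_atTop 0] with n hn hn0
    have := pow_le_pow_left₀ (by positivity) hn.le n
    rwa [one_div, Real.rpow_inv_natCast_pow (norm_nonneg _) hn0.ne', ← one_mul (ε ^ n)] at this
  obtain ⟨N, hN⟩ := eventually_atTop.1 hev'
  refine ⟨1 + ∑ k ∈ Finset.range N, ‖(C a b ^ k) 1‖ / ε ^ k, by positivity, fun n => ?_⟩
  have hs : 0 ≤ ∑ k ∈ Finset.range N, ‖(C a b ^ k) 1‖ / ε ^ k := by positivity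
  rcases le_or_gt N n with hn | hn
  · refine (hN n hn).trans ?_
    gcongr
    linarith
  · have h1 : ‖(C a b ^ n) 1‖ / ε ^ n ≤ ∑ k ∈ Finset.range N, ‖(C a b ^ k) 1‖ / ε ^ k :=
      Finset.single_le_sum (f := fun k => ‖(C a b ^ k) 1‖ / ε ^ k)
        (fun k _ => by positivity) (Finset.mem_range.2 hn)
    rw [← div_le_iff₀ (by positivity)]
    linarith

/-- Multiplication `x ↦ u x v` as a continuous linear operator. -/
noncomputable def mulLeftRightCLM (u v : A) : A →L[ℂ] A :=
  ContinuousLinearMap.mulLeftRight ℂ A u v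

theorem mulLeftRightCLM_apply (u v x : A) : mulLeftRightCLM u v x = u * x * v := by
  simp [mulLeftRightCLM]

theorem mulLeftRightCLM_pow_apply (u v x : A) (n : ℕ) :
    (mulLeftRightCLM u v ^ n) x = u ^ n * x * v ^ n := by
  induction n with
  | zero => simp
  | succ n ih =>
    rw [pow_succ', mul_apply_eq_comp, ih, mulLeftRightCLM_apply, pow_succ' u,
      pow_succ v]
    simp only [mul_assoc]

/-- `T - 1` is `C` followed by right multiplication by `v⁻¹`, and these two commute. -/
theorem mulLeftRightCLM_sub_one_pow_apply_one (u v : Aˣ) (n : ℕ) :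
    ((mulLeftRightCLM (u : A) ↑v⁻¹ - 1) ^ n) 1 = (C (u : A) v ^ n) 1 * (↑v⁻¹ : A) ^ n := by
  induction n with
  | zero => simp
  | succ n ih =>
    rw [pow_succ', pow_succ', mul_apply_eq_comp, ih, Module.End.mul_apply, C_apply,
      sub_apply, mulLeftRightCLM_apply, one_apply_eq_self,
      sub_mul, pow_succ' (↑v⁻¹ : A), mul_assoc _ (v : A), Units.mul_inv_cancel_left,
      ← pow_succ', pow_succ]
    simp only [mul_assoc]

theorem eq_of_rho_eq_zero_of_bddAbove [CompleteSpace A] {u v : A} (hu : IsUnit u) (hv : IsUnit v)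
    (hρ : rho u v = 0)
    (hb : BddAbove (Set.range fun n : ℤ => ‖intPow u n * intPow v (-n)‖)) : u = v := by
  obtain ⟨u, rfl⟩ := hu
  obtain ⟨v, rfl⟩ := hv
  obtain ⟨M, hM⟩ := hb
  have hM' : ∀ n : ℤ, ‖((u ^ n : Aˣ) : A) * ((v ^ (-n) : Aˣ) : A)‖ ≤ M := fun n => by
    have := hM ⟨n, rfl⟩
    simpa only [intPow_unit] using this
  have hlq : LocallyQuasinilpotent (mulLeftRightCLM (u : A) ↑v⁻¹ - 1) 1 := by
    intro ε hε
    obtain ⟨K, hK, hC⟩ := exists_norm_C_pow_le_of_rho_eq_zero hρ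
      (ε := ε / (‖(↑v⁻¹ : A)‖ + 1)) (by positivity)
    refine ⟨K * (1 + ‖(1 : A)‖), by positivity, fun k => ?_⟩
    rw [mulLeftRightCLM_sub_one_pow_apply_one]
    -- The factor `1 + ‖1‖` covers `k = 0`, as `‖1‖ = 1` is not assumed.
    have hpow : ‖(↑v⁻¹ : A) ^ k‖ ≤ (1 + ‖(1 : A)‖) * (‖(↑v⁻¹ : A)‖ + 1) ^ k := by
      rcases Nat.eq_zero_or_pos k with rfl | hk
      · simp
      · refine (norm_pow_le' _ hk).trans ?_
        calc ‖(↑v⁻¹ : A)‖ ^ k ≤ 1 * (‖(↑v⁻¹ : A)‖ + 1) ^ k := by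
              rw [one_mul]; gcongr; linarith
          _ ≤ _ := by gcongr; linarith [norm_nonneg (1 : A)]
    calc _ ≤ K * (ε / (‖(↑v⁻¹ : A)‖ + 1)) ^ k *
          ((1 + ‖(1 : A)‖) * (‖(↑v⁻¹ : A)‖ + 1) ^ k) :=
          (norm_mul_le _ _).trans (by gcongr; exact hC k)
      _ = _ := by rw [div_pow]; field_simp
  have hfix := apply_eq_self_of_locallyQuasinilpotent (M := M)
    (S := mulLeftRightCLM (↑u⁻¹ : A) (v : A)) hlq ?_ ?_ ?_
  · rw [mulLeftRightCLM_apply, mul_one, Units.mul_inv_eq_one] at hfix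
    exact hfix
  · ext x
    simp [mulLeftRightCLM_apply, mul_assoc]
  · intro n
    rw [mulLeftRightCLM_pow_apply, mul_one]
    simpa using hM' n
  · intro n
    rw [mulLeftRightCLM_pow_apply, mul_one]
    simpa using hM' (-n)

theorem rho_self (a : A) : rho a a = 0 := by
  have h1 : (C a a) 1 = 0 := by simp [C_apply]
  refine Tendsto.limsup_eq (tendsto_const_nhds.congr' ?_)
  filter_upwards [eventually_gt_atTop 0] with n hn
  obtain ⟨m, rfl⟩ := Nat.exists_eq_succ_of_ne_zero hn.ne'
  rw [Nat.succ_eq_add_one, pow_succ, Module.End.mul_apply, h1, map_zero, norm_zero,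
    Real.zero_rpow (by positivity)]

theorem bddAbove_norm_intPow_mul_intPow_neg {B : Type*} [NormedRing B] {a : B}
    (ha : IsUnit a) :
    BddAbove (Set.range fun n : ℤ => ‖intPow a n * intPow a (-n)‖) := by
  obtain ⟨u, rfl⟩ := ha
  refine ⟨‖(1 : B)‖, ?_⟩
  rintro _ ⟨n, rfl⟩
  simp only [intPow_unit, ← Units.val_mul, zpow_neg, mul_inv_cancel, Units.val_one]
  exact le_rfl

/-! ### Polynomial hulls and the choice of the shift -/

theorem subset_pco (K : Set ℂ) : K ⊆ pco K := fun z hz p =>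
  le_iSup₂ (f := fun w (_ : w ∈ K) => ‖p.eval w‖ₑ) z hz

theorem norm_le_of_mem_pco {K : Set ℂ} {R : ℝ} (hR : 0 ≤ R) (hK : ∀ w ∈ K, ‖w‖ ≤ R) {z : ℂ}
    (hz : z ∈ pco K) : ‖z‖ ≤ R := by
  have h1 := hz Polynomial.X
  simp only [Polynomial.eval_X] at h1
  have h2 : ‖z‖ₑ ≤ ENNReal.ofReal R := h1.trans <| iSup₂_le fun w hw => by
    rw [← ofReal_norm]
    exact ENNReal.ofReal_le_ofReal (hK w hw)
  rwa [← ofReal_norm, ENNReal.ofReal_le_ofReal_iff hR] at h2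

theorem exists_notMem_pco {K : Set ℂ} (hK : Bornology.IsBounded K) :
    ∃ α : ℂ, α ∉ pco K ∧ -α ∉ pco K := by
  obtain ⟨R, hR⟩ := isBounded_iff_forall_norm_le.1 hK
  have hα : ‖((|R| + 1 : ℝ) : ℂ)‖ = |R| + 1 := by
    rw [Complex.norm_real, Real.norm_of_nonneg (by positivity)]
  have hle : ∀ w ∈ K, ‖w‖ ≤ |R| := fun w hw => (hR w hw).trans (le_abs_self R)
  refine ⟨((|R| + 1 : ℝ) : ℂ), fun h => ?_, fun h => ?_⟩
  · linarith [norm_le_of_mem_pco (abs_nonneg R) hle h]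
  · have := norm_le_of_mem_pco (abs_nonneg R) hle h
    rw [norm_neg] at this
    linarith

theorem isUnit_algebraMap_add_of_neg_notMem_spectrum {a : A} {α : ℂ}
    (h : -α ∉ spectrum ℂ a) : IsUnit (algebraMap ℂ A α + a) := by
  rw [spectrum.notMem_iff, map_neg, ← neg_add', IsUnit.neg_iff] at h
  exact h

theorem isUnit_algebraMap_add_of_neg_notMem_pco {a b : A} {α : ℂ}
    (h : -α ∉ pco (spectrum ℂ a ∪ spectrum ℂ b)) :
    IsUnit (algebraMap ℂ A α + a) ∧ IsUnit (algebraMap ℂ A α + b) :=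
  ⟨isUnit_algebraMap_add_of_neg_notMem_spectrum fun h' => h (subset_pco _ (.inl h')),
    isUnit_algebraMap_add_of_neg_notMem_spectrum fun h' => h (subset_pco _ (.inr h'))⟩

theorem eq_of_rho_eq_zero_of_bddAbove_algebraMap_add [CompleteSpace A] {a b : A} {α : ℂ}
    (ha : IsUnit (algebraMap ℂ A α + a)) (hb : IsUnit (algebraMap ℂ A α + b)) (hρ : rho a b = 0)
    (hbdd : BddAbove (Set.range fun n : ℤ =>
      ‖intPow (algebraMap ℂ A α + a) n * intPow (algebraMap ℂ A α + b) (-n)‖)) : a = b :=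
  add_left_cancel (eq_of_rho_eq_zero_of_bddAbove ha hb
    (by rw [rho, C_algebraMap_add]; exact hρ) hbdd)

theorem exists_notMem_pco_spectrum [CompleteSpace A] (a b : A) :
    ∃ α : ℂ, α ∉ pco (spectrum ℂ a ∪ spectrum ℂ b) ∧ -α ∉ pco (spectrum ℂ a ∪ spectrum ℂ b) :=
  exists_notMem_pco ((spectrum.isBounded a).union (spectrum.isBounded b))

end GelfandGen


theorem theorem2p3 {A : Type*} [NormedRing A] [NormedAlgebra ℂ A] [CompleteSpace A] (a b : A) :
    (0 ∉ GelfandGen.pco (spectrum ℂ a ∪ spectrum ℂ b) →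
      IsUnit a ∧ IsUnit b ∧
      (a = b ↔ GelfandGen.rho a b = 0 ∧
        BddAbove (Set.range fun n : ℤ =>
          ‖GelfandGen.intPow a n * GelfandGen.intPow b (-n)‖))) ∧
    (a = b ↔ GelfandGen.rho a b = 0 ∧
      ∃ α : ℂ, -α ∉ GelfandGen.pco (spectrum ℂ a ∪ spectrum ℂ b) ∧
        BddAbove (Set.range fun n : ℤ =>
          ‖GelfandGen.intPow (algebraMap ℂ A α + a) n *
            GelfandGen.intPow (algebraMap ℂ A α + b) (-n)‖)) ∧
    (a = b ↔ GelfandGen.rho a b = 0 ∧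
      ∃ α : ℂ, α ∉ GelfandGen.pco (spectrum ℂ a ∪ spectrum ℂ b) ∧
        IsUnit (algebraMap ℂ A α + a) ∧ IsUnit (algebraMap ℂ A α + b) ∧
        BddAbove (Set.range fun n : ℤ =>
          ‖GelfandGen.intPow (algebraMap ℂ A α + a) n *
            GelfandGen.intPow (algebraMap ℂ A α + b) (-n)‖)) := by
  refine ⟨fun h0 => ?_, ?_, ?_⟩
  · obtain ⟨ha, hb⟩ := GelfandGen.isUnit_algebraMap_add_of_neg_notMem_pco (α := 0) (by simpa using h0)
    rw [map_zero, zero_add] at ha hb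
    refine ⟨ha, hb, ?_, fun h => GelfandGen.eq_of_rho_eq_zero_of_bddAbove ha hb h.1 h.2⟩
    rintro rfl
    exact ⟨GelfandGen.rho_self a, GelfandGen.bddAbove_norm_intPow_mul_intPow_neg ha⟩
  · constructor
    · rintro rfl
      obtain ⟨α, -, hα⟩ := GelfandGen.exists_notMem_pco_spectrum a a
      exact ⟨GelfandGen.rho_self a, α, hα, GelfandGen.bddAbove_norm_intPow_mul_intPow_neg
        (GelfandGen.isUnit_algebraMap_add_of_neg_notMem_pco hα).1⟩
    · rintro ⟨hρ, α, hα, hbdd⟩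
      obtain ⟨ha, hb⟩ := GelfandGen.isUnit_algebraMap_add_of_neg_notMem_pco hα
      exact GelfandGen.eq_of_rho_eq_zero_of_bddAbove_algebraMap_add ha hb hρ hbdd
  · constructor
    · rintro rfl
      -- Both signs are needed: `hα` is the stated condition, while `hα'` gives invertibility.
      obtain ⟨α, hα, hα'⟩ := GelfandGen.exists_notMem_pco_spectrum a a
      have ha := (GelfandGen.isUnit_algebraMap_add_of_neg_notMem_pco hα').1
      exact ⟨GelfandGen.rho_self a, α, hα, ha, ha,
        GelfandGen.bddAbove_norm_intPow_mul_intPow_neg ha⟩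
    · rintro ⟨hρ, α, -, ha, hb, hbdd⟩
      exact GelfandGen.eq_of_rho_eq_zero_of_bddAbove_algebraMap_add ha hb hρ hbdd
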